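/- \textbf{Conventions.} A \emph{polygon with $n$ sides} is a compact set $Q\subset\mathbb R^2$ that is the closure of its interior, whose interior is connected, and whose boundary is the union of the $n$ edges of a closed polygonal chain $P=(v_1,\dots,v_n)$ in which any three consecutive vertices are non-collinear and two different edges meet at most in points that are end points of both. (Simple polygons are the case of pairwise distinct $v_i$; in general the boundary may touch itself at vertices.) A \emph{billiard trajectory} in $Q$ from $A$ to $B$ is a non-constant path from $A$ to $B$ in $Q$ that consists of finitely many straight segments, meets no vertex of $P$ except possibly at its two end points, and changes direction only at relative interior points of edges, where its direction is reflected in the edge. Two points of $Q$ \emph{do not illuminate each other} if there is no billiard trajectory in $Q$ from one to the other. \textbf{Theorem.} There are a polygon $Q$ with $22$ sides, a right isosceles triangle $T_0$ and triangles $T_0,T_1,\dots,T_m$ with union $Q$ and pairwise disjoint interiors, each $T_j$ with $j\ge 1$ being the mirror image of some earlier $T_i$ ($i<j$) in one of the sides of $T_i$, and there are two distinct interior points $A\neq B$ of $Q$, each of them the vertex of some $T_j$ that corresponds (under these reflections) to one and the same acute vertex of $T_0$, such that $A$ and $B$ do not illuminate each other in $Q$. Moreover, no billiard trajectory in the triangle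 $T_0$ leads from an acute vertex of $T_0$ back to that same vertex. Consequently the minimal number of sides of a polygon that has a pair of distinct interior points that do not illuminate each other exists and is at most $22$. -/

import Mathlib

open scoped RealInnerProductSpace

/-- The Euclidean plane. -/
abbrev Plane : Type := EuclideanSpace ℝ (Fin 2)

/-- `IsPolygonalRegion P Q`: the closed set `Q` is the polygon (billiard table) whose sides are the
`n` edges of the closed polygonal chain `P`.  Every vertex is a genuine corner, so `n` really is the
number of sides, two edges meet at most in end points of both, and `Q` is a compact regular closed
set with connected interior and boundary `P`.  If moreover `P.vertices` is injective, `P` is a simple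
closed polygonal curve and `Q` is that curve together with its inside; in general the boundary is
allowed to touch itself, but at vertices only. -/
structure IsPolygonalRegion {n : ℕ} [NeZero n] (P : Polygon Plane n) (Q : Set Plane) : Prop where
  corners : P.HasNondegenerateVertices ℝ
  edges_inter : ∀ i j : Fin n, i ≠ j →
    P.edgeSet ℝ i ∩ P.edgeSet ℝ j ⊆ {P i, P (finRotate n i)} ∩ {P j, P (finRotate n j)}
  isCompact : IsCompact Q
  closure_interior : closure (interior Q) = Q
  isConnected_interior : IsConnected (interior Q)
  frontier_eq : frontier Q = P.boundary ℝ

/-- `x 0, x 1, …, x k` are the successive break points of a billiard trajectory in the table `Q` with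
boundary chain `P`: the trajectory moves along straight segments in `Q`, meets no vertex of `P` except
possibly at its two end points, and every intermediate break point lies in the relative interior of
an edge, where the direction of motion is reflected in that edge. -/
structure IsBilliardTrajectory {n : ℕ} (P : Polygon Plane n) (Q : Set Plane) (k : ℕ)
    (x : ℕ → Plane) : Prop where
  ne : ∀ i < k, x i ≠ x (i + 1)
  segment_subset : ∀ i < k, openSegment ℝ (x i) (x (i + 1)) ⊆ Q \ Set.range P.vertices
  bounce : ∀ i, i + 1 < k → ∃ j : Fin n,
    x (i + 1) ∈ openSegment ℝ (P j) (P (finRotate n j)) ∧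
    SameRay ℝ ((Submodule.span ℝ {P (finRotate n j) - P j}).reflection (x (i + 1) - x i))
      (x (i + 2) - x (i + 1))

/-- There is a (nonconstant) billiard trajectory from `A` to `B`. -/
def Illuminates {n : ℕ} (P : Polygon Plane n) (Q : Set Plane) (A B : Plane) : Prop :=
  ∃ (k : ℕ) (x : ℕ → Plane), 0 < k ∧ IsBilliardTrajectory P Q k x ∧ x 0 = A ∧ x k = B

/-- Right isosceles triangle, with the right angle at vertex `1`; the acute vertices are `0`, `2`. -/
def IsRightIsosceles (T : Affine.Triangle ℝ Plane) : Prop :=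
  EuclideanGeometry.angle (T.points 0) (T.points 1) (T.points 2) = Real.pi / 2 ∧
  dist (T.points 0) (T.points 1) = dist (T.points 1) (T.points 2)

/-- The triangle `T'` is the mirror image of `T` in one of the sides of `T`, with corresponding
vertices carrying the same label. -/
def IsSideReflection (T T' : Affine.Triangle ℝ Plane) : Prop :=
  ∃ a b : Fin 3, a ≠ b ∧
    ∀ l, T'.points l = EuclideanGeometry.reflection (line[ℝ, T.points a, T.points b]) (T.points l)

/-- The triangles `T 0, …, T m` tile `Q`, and each of them except `T 0` is obtained from an earlier
one by reflecting it in one of its sides. -/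
structure IsReflectionTiling {m : ℕ} (T : Fin (m + 1) → Affine.Triangle ℝ Plane) (Q : Set Plane) :
    Prop where
  reflect : ∀ j, j ≠ 0 → ∃ i < j, IsSideReflection (T i) (T j)
  disjoint : ∀ i j, i ≠ j → Disjoint (T i).interior (T j).interior
  iUnion_eq : ⋃ i, (T i).closedInterior = Q

/-- The numbers `n` such that some `n`-sided polygon has two distinct interior points that do not
illuminate each other. -/
def nonIlluminableSideNumbers : Set ℕ :=
  {n | ∃ (_ : NeZero n) (P : Polygon Plane n) (Q : Set Plane), IsPolygonalRegion P Q ∧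
    ∃ A ∈ interior Q, ∃ B ∈ interior Q, A ≠ B ∧ ¬ Illuminates P Q A B}

/-! Tile the plane by right isosceles triangles with unit legs so that the acute vertices are the
integer points with both coordinates even or both odd, and the right angles sit at the points of
mixed parity. Reflection in an edge of this tiling preserves the integer lattice and each class
`latticeClass c`. A billiard trajectory whose walls are tile edges therefore unfolds to one straight
segment, and if it joins two points of class `c`, so does the segment. Its end points differ by a
vector with even coordinates; dividing this vector by the largest power of 2 common to both
coordinates gives a lattice point strictly inside the segment and outside class `c`
(`exists_between_latticeClass`). If all lattice points of the table outside class `c` are vertices,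
folding back puts a vertex in the middle of the trajectory, a contradiction
(`not_illuminates_of_latticeClass`).

In a single tile every lattice point is a vertex, so no trajectory returns to the acute vertex it
started from. For the polygon, take the squares of side 2 around `(0, 0)` and `(2, 2)`, attach tiles
as wings, and join the squares through two tiles at `(2, 0)`. Every lattice point of the union that
is not even in both coordinates is a corner, while both centres are interior. It remains to see that
the union is a polygon: the explicit open set `openRegion` is connected and lies in it, every other
point is on the chain (`tiledRegion_subset`), and every chain edge borders a tile outside
(`boundary_subset_closure_compl`). The combinatorics of the 24 tiles and 22 edges is finite and
decided by computation. -/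

/-- The point of the plane with given integer coordinates. -/
def latticePoint (z : ℤ × ℤ) : Plane := !₂[(z.1 : ℝ), (z.2 : ℝ)]

@[simp] lemma latticePoint_zero (z : ℤ × ℤ) : latticePoint z 0 = z.1 := rfl
@[simp] lemma latticePoint_one (z : ℤ × ℤ) : latticePoint z 1 = z.2 := rfl

lemma plane_ext {p q : Plane} (h₀ : p 0 = q 0) (h₁ : p 1 = q 1) : p = q := by
  ext i; fin_cases i <;> assumption

lemma plane_inner (p q : Plane) : inner ℝ p q = p 0 * q 0 + p 1 * q 1 := by
  simp [PiLp.inner_apply, Fin.sum_univ_two, mul_comm]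

lemma latticePoint_injective : Function.Injective latticePoint := fun z w h ↦ by
  have h₀ := congrArg (· 0) h
  have h₁ := congrArg (· 1) h
  simp only [latticePoint_zero, latticePoint_one, Int.cast_inj] at h₀ h₁
  exact Prod.ext h₀ h₁

lemma affineIndependent_of_det_ne_zero {p q r : Plane}
    (h : (q 0 - p 0) * (r 1 - p 1) - (q 1 - p 1) * (r 0 - p 0) ≠ 0) :
    AffineIndependent ℝ ![p, q, r] := by
  rw [affineIndependent_iff_not_collinear_set, collinear_iff_of_mem (p₀ := p) (by simp)]
  rintro ⟨v, hv⟩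
  obtain ⟨a, ha⟩ := hv q (by simp)
  obtain ⟨b, hb⟩ := hv r (by simp)
  apply h
  simp only [ha, hb, vadd_eq_add, PiLp.add_apply, PiLp.smul_apply, smul_eq_mul]
  ring

/-! ### Tiles and their linear coordinates -/

/-- A tile of the tiling of the plane by right isosceles triangles with unit legs whose acute
vertices have coordinates that are both even or both odd.  Its even vertex is `(2 * a, 2 * b)`, the
signs `s` and `t` tell the quadrant, and `w` tells whether the leg at the even vertex is vertical. -/
structure Tile where
  a : ℤ
  b : ℤ
  s : Bool
  t : Bool
  w : Bool
  deriving DecidableEq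

/-- `1` for `true` and `-1` for `false`. -/
def boolSign (s : Bool) : ℤ := if s then 1 else -1

namespace Tile

/-- The vertices of a tile; the right angle is at vertex `1`. -/
def vert (τ : Tile) : Fin 3 → ℤ × ℤ
  | 0 => (2 * τ.a, 2 * τ.b)
  | 1 => if τ.w then (2 * τ.a, 2 * τ.b + boolSign τ.t) else (2 * τ.a + boolSign τ.s, 2 * τ.b)
  | 2 => (2 * τ.a + boolSign τ.s, 2 * τ.b + boolSign τ.t)

/-- The coordinate along the leg from vertex `0` to vertex `1`. -/
noncomputable def alpha (τ : Tile) (p : Plane) : ℝ :=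
  if τ.w then boolSign τ.t * (p 1 - 2 * τ.b) else boolSign τ.s * (p 0 - 2 * τ.a)

/-- The coordinate along the leg from vertex `1` to vertex `2`. -/
noncomputable def beta (τ : Tile) (p : Plane) : ℝ :=
  if τ.w then boolSign τ.s * (p 0 - 2 * τ.a) else boolSign τ.t * (p 1 - 2 * τ.b)

/-- The triangle of a tile. -/
noncomputable def triangle (τ : Tile) : Affine.Triangle ℝ Plane where
  points l := latticePoint (τ.vert l)
  independent := by
    have : (fun l ↦ latticePoint (τ.vert l)) = ![latticePoint (τ.vert 0), latticePoint (τ.vert 1),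
      latticePoint (τ.vert 2)] := by ext1 l; fin_cases l <;> rfl
    rw [this]
    apply affineIndependent_of_det_ne_zero
    obtain ⟨a, b, s, t, w⟩ := τ
    cases s <;> cases t <;> cases w <;> simp [vert, boolSign]

/-- In the coordinates `(alpha, beta)` the vertices are `(0, 0)`, `(1, 0)`, `(1, 1)`, which gives
these barycentric coordinates. Membership in a tile thereby becomes a system of linear inequalities.
-/
lemma combination_eq_iff (τ : Tile) (p : Plane) (w : Fin 3 → ℝ) (hw : ∑ i, w i = 1) :
    Finset.univ.affineCombination ℝ τ.triangle.points w = p ↔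
      w 0 = 1 - τ.alpha p ∧ w 1 = τ.alpha p - τ.beta p ∧ w 2 = τ.beta p := by
  rw [Finset.affineCombination_eq_linear_combination _ _ _ hw, Fin.sum_univ_three]
  rw [Fin.sum_univ_three] at hw
  have key : ∀ q : Plane, q = p ↔ q 0 = p 0 ∧ q 1 = p 1 :=
    fun q ↦ ⟨by rintro rfl; simp, fun h ↦ plane_ext h.1 h.2⟩
  rw [key]
  obtain ⟨a, b, s, t, v⟩ := τ
  have h0 : w 0 = 1 - w 1 - w 2 := by linarith
  cases s <;> cases t <;> cases v <;>
    simp [triangle, vert, boolSign, alpha, beta, h0] <;>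
    constructor <;> rintro h <;> (try constructorm* _ ∧ _) <;> linarith

lemma mem_setInterior_iff (τ : Tile) (p : Plane) (I : Set ℝ) :
    p ∈ τ.triangle.setInterior I ↔
      1 - τ.alpha p ∈ I ∧ τ.alpha p - τ.beta p ∈ I ∧ τ.beta p ∈ I := by
  constructor
  · rintro ⟨w, hw, hI, hp⟩
    obtain ⟨h₀, h₁, h₂⟩ := (τ.combination_eq_iff p w hw).1 hp
    rw [← h₀, ← h₁, ← h₂]
    exact ⟨hI 0, hI 1, hI 2⟩
  · rintro ⟨h₀, h₁, h₂⟩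
    have hw : ∑ i, ![1 - τ.alpha p, τ.alpha p - τ.beta p, τ.beta p] i = 1 := by
      simp [Fin.sum_univ_three]
    refine ⟨_, hw, ?_, (τ.combination_eq_iff p _ hw).2 (by simp)⟩
    intro i
    fin_cases i <;> simpa

lemma mem_closedInterior_iff {τ : Tile} {p : Plane} :
    p ∈ τ.triangle.closedInterior ↔ 0 ≤ τ.beta p ∧ τ.beta p ≤ τ.alpha p ∧ τ.alpha p ≤ 1 := by
  rw [Affine.Simplex.closedInterior, mem_setInterior_iff]
  simp only [Set.mem_Icc]
  constructor
  · rintro ⟨⟨_, _⟩, ⟨_, _⟩, ⟨_, _⟩⟩; refine ⟨?_, ?_, ?_⟩ <;> linarith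
  · rintro ⟨_, _, _⟩; refine ⟨⟨?_, ?_⟩, ⟨?_, ?_⟩, ?_, ?_⟩ <;> linarith

lemma mem_interior_iff {τ : Tile} {p : Plane} :
    p ∈ τ.triangle.interior ↔ 0 < τ.beta p ∧ τ.beta p < τ.alpha p ∧ τ.alpha p < 1 := by
  rw [Affine.Simplex.interior, mem_setInterior_iff]
  simp only [Set.mem_Ioo]
  constructor
  · rintro ⟨⟨_, _⟩, ⟨_, _⟩, ⟨_, _⟩⟩; refine ⟨?_, ?_, ?_⟩ <;> linarith
  · rintro ⟨_, _, _⟩; refine ⟨⟨?_, ?_⟩, ⟨?_, ?_⟩, ?_, ?_⟩ <;> linarith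

/-- The point with given coordinates with respect to a tile. -/
noncomputable def point (τ : Tile) (x y : ℝ) : Plane :=
  if τ.w then !₂[2 * τ.a + boolSign τ.s * y, 2 * τ.b + boolSign τ.t * x]
  else !₂[2 * τ.a + boolSign τ.s * x, 2 * τ.b + boolSign τ.t * y]

lemma boolSign_mul_self (s : Bool) : (boolSign s : ℝ) * boolSign s = 1 := by
  cases s <;> simp [boolSign]

@[simp] lemma alpha_point (τ : Tile) (x y : ℝ) : τ.alpha (τ.point x y) = x := by
  obtain ⟨a, b, s, t, w⟩ := τ
  cases w <;> simp [alpha, point, ← mul_assoc, boolSign_mul_self]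

@[simp] lemma beta_point (τ : Tile) (x y : ℝ) : τ.beta (τ.point x y) = y := by
  obtain ⟨a, b, s, t, w⟩ := τ
  cases w <;> simp [beta, point, ← mul_assoc, boolSign_mul_self]

lemma point_alpha_beta (τ : Tile) (p : Plane) : τ.point (τ.alpha p) (τ.beta p) = p := by
  obtain ⟨a, b, s, t, w⟩ := τ
  cases w <;> apply plane_ext <;> simp [alpha, beta, point, ← mul_assoc, boolSign_mul_self]

@[fun_prop] lemma continuous_point (τ : Tile) : Continuous fun z : ℝ × ℝ ↦ τ.point z.1 z.2 := by
  obtain ⟨a, b, s, t, w⟩ := τ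
  cases w <;> simp only [point, if_true, Bool.false_eq_true, if_false] <;> fun_prop

@[fun_prop] lemma continuous_alpha (τ : Tile) : Continuous τ.alpha := by
  unfold alpha; split <;> fun_prop

@[fun_prop] lemma continuous_beta (τ : Tile) : Continuous τ.beta := by
  unfold beta; split <;> fun_prop

lemma alpha_combo (τ : Tile) (p q : Plane) {u v : ℝ} (h : u + v = 1) :
    τ.alpha (u • p + v • q) = u * τ.alpha p + v * τ.alpha q := by
  obtain rfl : u = 1 - v := by linarith
  unfold alpha; split <;> simp <;> ring

lemma beta_combo (τ : Tile) (p q : Plane) {u v : ℝ} (h : u + v = 1) :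
    τ.beta (u • p + v • q) = u * τ.beta p + v * τ.beta q := by
  obtain rfl : u = 1 - v := by linarith
  unfold beta; split <;> simp <;> ring

lemma closedInterior_subset_closure_interior (τ : Tile) :
    τ.triangle.closedInterior ⊆ closure τ.triangle.interior := by
  intro p hp
  rw [mem_closedInterior_iff] at hp
  obtain ⟨h₀, h₁, h₂⟩ := hp
  -- Slide `p` towards the barycentre, which has coordinates `(2 / 3, 1 / 3)`.
  let f : ℝ → Plane := fun u ↦
    τ.point ((1 - u) * τ.alpha p + u * (2 / 3)) ((1 - u) * τ.beta p + u * (1 / 3))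
  have hf : Continuous f := τ.continuous_point.comp (by fun_prop :
    Continuous fun u : ℝ ↦ ((1 - u) * τ.alpha p + u * (2 / 3), (1 - u) * τ.beta p + u * (1 / 3)))
  have hf0 : f 0 = p := by simp [f, point_alpha_beta]
  have : (0 : ℝ) ∈ closure (Set.Ioo (0 : ℝ) 1) := by
    rw [closure_Ioo (by norm_num)]; simp
  rw [← hf0]
  refine map_mem_closure hf this fun u hu ↦ ?_
  obtain ⟨hu0, hu1⟩ := hu
  rw [mem_interior_iff]
  simp only [f, alpha_point, beta_point]
  refine ⟨?_, ?_, ?_⟩ <;> nlinarith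

/-! ### Mirror images of tiles -/

/-- The mirror image of a tile in the side opposite to vertex `2`, `1`, `0` respectively. -/
def mirror (τ : Tile) : Fin 3 → Tile
  | 0 => if τ.w then { τ with s := !τ.s } else { τ with t := !τ.t }
  | 1 => { τ with w := !τ.w }
  | 2 => if τ.w then { τ with b := τ.b + boolSign τ.t, t := !τ.t }
    else { τ with a := τ.a + boolSign τ.s, s := !τ.s }

lemma reflection_eq_of_inner_eq_zero {p q r r' : Plane} (hm : midpoint ℝ r r' ∈ line[ℝ, p, q])
    (ho : inner ℝ (q - p) (r - r') = 0) : EuclideanGeometry.reflection (line[ℝ, p, q]) r = r' := by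
  have hv : (2⁻¹ : ℝ) • (r - r') ∈ (line[ℝ, p, q]).directionᗮ := by
    rw [direction_affineSpan, vectorSpan_pair_rev, Submodule.mem_orthogonal_singleton_iff_inner_right]
    simp [inner_smul_right, ho]
  have := EuclideanGeometry.reflection_orthogonal_vadd hm hv
  have h1 : (2⁻¹ : ℝ) • (r - r') +ᵥ midpoint ℝ r r' = r := by
    rw [midpoint_eq_smul_add, vadd_eq_add, invOf_eq_inv]; module
  have h2 : -((2⁻¹ : ℝ) • (r - r')) +ᵥ midpoint ℝ r r' = r' := by
    rw [midpoint_eq_smul_add, vadd_eq_add, invOf_eq_inv]; module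
  rwa [h1, h2] at this

lemma isSideReflection_of_vert {τ σ : Tile} (a b c : Fin 3) (hab : a ≠ b) (hac : a ≠ c)
    (hbc : b ≠ c) (ha : σ.vert a = τ.vert a) (hb : σ.vert b = τ.vert b)
    (hm : ∃ r : ℝ, midpoint ℝ (latticePoint (τ.vert c)) (latticePoint (σ.vert c)) =
      AffineMap.lineMap (latticePoint (τ.vert a)) (latticePoint (τ.vert b)) r)
    (ho : inner ℝ (latticePoint (τ.vert b) - latticePoint (τ.vert a))
      (latticePoint (τ.vert c) - latticePoint (σ.vert c)) = 0) :
    IsSideReflection τ.triangle σ.triangle := by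
  refine ⟨a, b, hab, fun l ↦ ?_⟩
  have hl : l = a ∨ l = b ∨ l = c := by omega
  symm
  rcases hl with rfl | rfl | rfl
  · simp only [triangle, ha]
    exact (EuclideanGeometry.reflection_eq_self_iff _).2 (left_mem_affineSpan_pair ..)
  · simp only [triangle, hb]
    exact (EuclideanGeometry.reflection_eq_self_iff _).2 (right_mem_affineSpan_pair ..)
  · obtain ⟨r, hr⟩ := hm
    refine reflection_eq_of_inner_eq_zero ?_ ho
    simp only [triangle]
    rw [hr]
    exact AffineMap.lineMap_mem_affineSpan_pair ..

lemma isSideReflection_mirror (τ : Tile) (k : Fin 3) :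
    IsSideReflection τ.triangle (τ.mirror k).triangle := by
  obtain ⟨a, b, s, t, w⟩ := τ
  fin_cases k
  · apply isSideReflection_of_vert 0 1 2 (by decide) (by decide) (by decide)
    · cases w <;> simp [mirror, vert]
    · cases w <;> simp [mirror, vert]
    -- The foot of the perpendicular: vertex `1` when a leg is the mirror (parameter 1 here, 0 in
    -- the last case), the midpoint of the hypotenuse otherwise.
    · refine ⟨1, ?_⟩
      cases s <;> cases t <;> cases w <;> apply plane_ext <;>
        simp [mirror, vert, boolSign, midpoint_eq_smul_add, AffineMap.lineMap_apply] <;> ring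
    · cases s <;> cases t <;> cases w <;> simp [mirror, vert, boolSign, plane_inner]
  · apply isSideReflection_of_vert 0 2 1 (by decide) (by decide) (by decide)
    · cases w <;> simp [mirror, vert]
    · cases w <;> simp [mirror, vert]
    · refine ⟨1 / 2, ?_⟩
      cases s <;> cases t <;> cases w <;> apply plane_ext <;>
        simp [mirror, vert, boolSign, midpoint_eq_smul_add, AffineMap.lineMap_apply] <;> ring
    · cases s <;> cases t <;> cases w <;> simp [mirror, vert, boolSign, plane_inner]
  · apply isSideReflection_of_vert 1 2 0 (by decide) (by decide) (by decide)
    · cases s <;> cases t <;> cases w <;> simp [mirror, vert, boolSign] <;> ring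
    · cases s <;> cases t <;> cases w <;> simp [mirror, vert, boolSign] <;> ring
    · refine ⟨0, ?_⟩
      cases s <;> cases t <;> cases w <;> apply plane_ext <;>
        simp [mirror, vert, boolSign, midpoint_eq_smul_add, AffineMap.lineMap_apply] <;> ring
    · cases s <;> cases t <;> cases w <;> simp [mirror, vert, boolSign, plane_inner]

lemma isRightIsosceles (τ : Tile) : IsRightIsosceles τ.triangle := by
  obtain ⟨a, b, s, t, w⟩ := τ
  constructor
  · rw [EuclideanGeometry.angle, ← InnerProductGeometry.inner_eq_zero_iff_angle_eq_pi_div_two,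
      plane_inner]
    cases w <;> simp [triangle, vert]
  · simp only [EuclideanSpace.dist_eq, Fin.sum_univ_two]
    cases s <;> cases t <;> cases w <;> simp [triangle, vert, boolSign]

/-! ### Disjointness of tiles and their lattice points -/

lemma abs_sub_lt_one_of_mem_interior {τ : Tile} {p : Plane} (h : p ∈ τ.triangle.interior) :
    |p 0 - 2 * τ.a| < 1 ∧ |p 1 - 2 * τ.b| < 1 := by
  rw [mem_interior_iff] at h
  obtain ⟨a, b, s, t, w⟩ := τ
  obtain ⟨h₀, h₁, h₂⟩ := h
  rw [abs_lt, abs_lt]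
  cases s <;> cases t <;> cases w <;> simp [alpha, beta, boolSign] at * <;>
    refine ⟨⟨?_, ?_⟩, ?_, ?_⟩ <;> linarith

lemma abs_sub_le_one_of_mem_closedInterior {τ : Tile} {p : Plane}
    (h : p ∈ τ.triangle.closedInterior) : |p 0 - 2 * τ.a| ≤ 1 ∧ |p 1 - 2 * τ.b| ≤ 1 := by
  rw [mem_closedInterior_iff] at h
  obtain ⟨a, b, s, t, w⟩ := τ
  obtain ⟨h₀, h₁, h₂⟩ := h
  rw [abs_le, abs_le]
  cases s <;> cases t <;> cases w <;> simp [alpha, beta, boolSign] at * <;>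
    refine ⟨⟨?_, ?_⟩, ?_, ?_⟩ <;> linarith

lemma int_eq_of_abs_sub {x : ℝ} {a b : ℤ} (ha : |x - 2 * a| < 1) (hb : |x - 2 * b| ≤ 1) :
    a = b := by
  rw [abs_lt] at ha
  rw [abs_le] at hb
  have h₁ : (a : ℝ) - b < 1 := by linarith
  have h₂ : (b : ℝ) - a < 1 := by linarith
  norm_cast at h₁ h₂
  omega

/-- A tile lies in the square of half-width 1 around its even vertex, so a common point forces equal
even vertices; the eight tiles around one vertex are told apart by signs and by the order of the
coordinates. -/
lemma eq_of_mem_interior {τ σ : Tile} {p : Plane} (hτ : p ∈ τ.triangle.interior)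
    (hσ : p ∈ σ.triangle.closedInterior) : τ = σ := by
  have ha := int_eq_of_abs_sub (abs_sub_lt_one_of_mem_interior hτ).1
    (abs_sub_le_one_of_mem_closedInterior hσ).1
  have hb := int_eq_of_abs_sub (abs_sub_lt_one_of_mem_interior hτ).2
    (abs_sub_le_one_of_mem_closedInterior hσ).2
  rw [mem_interior_iff] at hτ
  rw [mem_closedInterior_iff] at hσ
  obtain ⟨h₀, h₁, h₂⟩ := hτ
  obtain ⟨k₀, k₁, k₂⟩ := hσ
  obtain ⟨a, b, s, t, w⟩ := τ
  obtain ⟨a', b', s', t', w'⟩ := σ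
  obtain rfl : a = a' := ha
  obtain rfl : b = b' := hb
  simp only [mk.injEq, true_and]
  unfold alpha beta at *
  generalize p 0 - 2 * (a : ℝ) = x at *
  generalize p 1 - 2 * (b : ℝ) = y at *
  cases s <;> cases s' <;> cases t <;> cases t' <;> cases w <;> cases w' <;>
    first | decide | (exfalso; simp [boolSign] at *; linarith)

lemma exists_vert_of_latticePoint_mem {τ : Tile} {z : ℤ × ℤ}
    (h : latticePoint z ∈ τ.triangle.closedInterior) : ∃ l, z = τ.vert l := by
  rw [mem_closedInterior_iff] at h
  obtain ⟨a, b, s, t, w⟩ := τ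
  obtain ⟨x, y⟩ := z
  obtain ⟨h₀, h₁, h₂⟩ := h
  have : (x, y) = vert ⟨a, b, s, t, w⟩ 0 ∨ (x, y) = vert ⟨a, b, s, t, w⟩ 1 ∨
      (x, y) = vert ⟨a, b, s, t, w⟩ 2 := by
    cases s <;> cases t <;> cases w <;> simp [alpha, beta, boolSign, vert] at * <;>
      norm_cast at * <;> omega
  tauto

end Tile

/-! ### Parity classes and reflections -/

/-- The points with integer coordinates that are both congruent to `c` modulo `2`. -/
def latticeClass (c : ℤ) : Set Plane :=
  {p | ∃ z : ℤ × ℤ, p = latticePoint z ∧ z.1 ≡ c [ZMOD 2] ∧ z.2 ≡ c [ZMOD 2]}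

/-- The segment between two neighbouring lattice points is an edge of the tiling. -/
def IsTileEdge (v w : ℤ × ℤ) : Prop :=
  (w.1 = v.1 ∧ |w.2 - v.2| = 1) ∨ (w.2 = v.2 ∧ |w.1 - v.1| = 1) ∨
    (|w.1 - v.1| = 1 ∧ |w.2 - v.2| = 1 ∧ 2 ∣ v.1 + v.2)

instance (v w : ℤ × ℤ) : Decidable (IsTileEdge v w) := by unfold IsTileEdge; infer_instance

/-- The reflection in the line through `v` with direction `d`. -/
noncomputable def lineReflection (v d : Plane) : Plane ≃ᵃ[ℝ] Plane :=
  AffineEquiv.mk' (fun p ↦ (Submodule.span ℝ {d}).reflection (p - v) + v)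
    (Submodule.span ℝ {d}).reflection.toLinearEquiv v (fun p ↦ by simp)

lemma lineReflection_apply (v d p : Plane) :
    lineReflection v d p = (Submodule.span ℝ {d}).reflection (p - v) + v := rfl

lemma lineReflection_involutive (v d p : Plane) :
    lineReflection v d (lineReflection v d p) = p := by
  simp [lineReflection_apply]

lemma lineReflection_sub (v d p q : Plane) :
    lineReflection v d p - lineReflection v d q = (Submodule.span ℝ {d}).reflection (p - q) := by
  simp only [lineReflection_apply, map_sub]; abel

lemma lineReflection_lineMap (v w : Plane) (r : ℝ) :
    lineReflection v (w - v) (AffineMap.lineMap v w r) = AffineMap.lineMap v w r := by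
  rw [lineReflection_apply, AffineMap.lineMap_apply, vsub_eq_sub, vadd_eq_add, add_sub_cancel_right,
    (Submodule.reflection_eq_self_iff _ ).2]
  exact Submodule.smul_mem _ _ (Submodule.mem_span_singleton_self _)

/-- Horizontal and vertical mirrors change a coordinate by an even number. A diagonal mirror swaps
the coordinates up to sign and a shift by `v.1 ± v.2`, which is even by `IsTileEdge`; hence points
of equal parities keep their class. -/
lemma exists_lineReflection_latticePoint {v w : ℤ × ℤ} (h : IsTileEdge v w) (z : ℤ × ℤ) :
    ∃ z', lineReflection (latticePoint v) (latticePoint w - latticePoint v) (latticePoint z) =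
      latticePoint z' ∧
      ∀ c, z.1 ≡ c [ZMOD 2] ∧ z.2 ≡ c [ZMOD 2] → z'.1 ≡ c [ZMOD 2] ∧ z'.2 ≡ c [ZMOD 2] := by
  obtain ⟨v₁, v₂⟩ := v
  obtain ⟨w₁, w₂⟩ := w
  obtain ⟨z₁, z₂⟩ := z
  have key : ∀ z' : ℤ × ℤ, midpoint ℝ (latticePoint (z₁, z₂)) (latticePoint z') -
        latticePoint (v₁, v₂) ∈
        Submodule.span ℝ {latticePoint (w₁, w₂) - latticePoint (v₁, v₂)} →
      inner ℝ (latticePoint (w₁, w₂) - latticePoint (v₁, v₂))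
        (latticePoint (z₁, z₂) - latticePoint z') = 0 →
      lineReflection (latticePoint (v₁, v₂)) (latticePoint (w₁, w₂) - latticePoint (v₁, v₂))
        (latticePoint (z₁, z₂)) = latticePoint z' := by
    intro z' hm ho
    have hv : (2⁻¹ : ℝ) • (latticePoint (z₁, z₂) - latticePoint z') ∈
        (Submodule.span ℝ {latticePoint (w₁, w₂) - latticePoint (v₁, v₂)})ᗮ := by
      rw [Submodule.mem_orthogonal_singleton_iff_inner_right]
      simp [inner_smul_right, ho]
    have e : latticePoint (z₁, z₂) - latticePoint (v₁, v₂) =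
        (2⁻¹ : ℝ) • (latticePoint (z₁, z₂) - latticePoint z') +
          (midpoint ℝ (latticePoint (z₁, z₂)) (latticePoint z') - latticePoint (v₁, v₂)) := by
      rw [midpoint_eq_smul_add, invOf_eq_inv]; module
    rw [lineReflection_apply, e, map_add, Submodule.reflection_mem_subspace_eq_self hm,
      Submodule.reflection_mem_subspace_orthogonalComplement_eq_neg hv, midpoint_eq_smul_add,
      invOf_eq_inv]
    module
  rcases h with ⟨h₁, h₂⟩ | ⟨h₁, h₂⟩ | ⟨h₁, h₂, h₃⟩
  · simp only at h₁ h₂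
    subst h₁
    refine ⟨(2 * w₁ - z₁, z₂), key _ ?_ ?_, ?_⟩
    · rw [Submodule.mem_span_singleton]
      refine ⟨(w₂ - v₂) * (z₂ - v₂), plane_ext ?_ ?_⟩
      · simp [midpoint_eq_smul_add]; ring
      · have : ((w₂ : ℝ) - v₂) ^ 2 = 1 := by
          rw [← sq_abs]; exact_mod_cast (by rw [h₂]; rfl : |w₂ - v₂| ^ 2 = 1)
        simp [midpoint_eq_smul_add]
        linear_combination (z₂ - v₂ : ℝ) * this
    · simp [plane_inner]
    · simp only [Int.ModEq]; omega
  · simp only at h₁ h₂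
    subst h₁
    refine ⟨(z₁, 2 * w₂ - z₂), key _ ?_ ?_, ?_⟩
    · rw [Submodule.mem_span_singleton]
      refine ⟨(w₁ - v₁) * (z₁ - v₁), plane_ext ?_ ?_⟩
      · have : ((w₁ : ℝ) - v₁) ^ 2 = 1 := by
          rw [← sq_abs]; exact_mod_cast (by rw [h₂]; rfl : |w₁ - v₁| ^ 2 = 1)
        simp [midpoint_eq_smul_add]
        linear_combination (z₁ - v₁ : ℝ) * this
      · simp [midpoint_eq_smul_add]; ring
    · simp [plane_inner]
    · simp only [Int.ModEq]; omega
  · simp only at h₁ h₂ h₃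
    rw [abs_eq (by norm_num)] at h₁ h₂
    -- `e` is the slope of the diagonal edge and `d` its horizontal orientation.
    obtain ⟨e, he, h₂'⟩ : ∃ e, (e = 1 ∨ e = -1) ∧ w₂ - v₂ = e * (w₁ - v₁) :=
      ⟨(w₂ - v₂) * (w₁ - v₁), by rcases h₁ with h | h <;> rcases h₂ with h' | h' <;> simp [h, h'],
        by rcases h₁ with h | h <;> rcases h₂ with h' | h' <;> simp [h, h']⟩
    obtain ⟨d, hd, h₁'⟩ : ∃ d, (d = 1 ∨ d = -1) ∧ w₁ = v₁ + d := ⟨w₁ - v₁, h₁, by ring⟩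
    obtain rfl : w₂ = v₂ + e * d := by rw [h₁'] at h₂'; linarith
    subst h₁'
    refine ⟨(v₁ + e * (z₂ - v₂), v₂ + e * (z₁ - v₁)), key _ ?_ ?_, ?_⟩
    · rw [Submodule.mem_span_singleton]
      refine ⟨d * ((z₁ - v₁) + e * (z₂ - v₂)) / 2, plane_ext ?_ ?_⟩ <;>
      rcases he with rfl | rfl <;> rcases hd with rfl | rfl <;>
        simp [midpoint_eq_smul_add] <;> ring
    · rcases he with rfl | rfl <;> rcases hd with rfl | rfl <;> simp [plane_inner] <;> ring
    · simp only [Int.ModEq]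
      rcases he with rfl | rfl <;> omega

/-- A map that preserves the integer lattice and its points of class `c`. -/
def PreservesLattice (c : ℤ) (g : Plane ≃ᵃ[ℝ] Plane) : Prop :=
  ∀ p, (g p ∈ Set.range latticePoint ↔ p ∈ Set.range latticePoint) ∧
    (g p ∈ latticeClass c ↔ p ∈ latticeClass c)

lemma preservesLattice_lineReflection (c : ℤ) {v w : ℤ × ℤ} (h : IsTileEdge v w) :
    PreservesLattice c
      (lineReflection (latticePoint v) (latticePoint w - latticePoint v)) := by
  set s := lineReflection (latticePoint v) (latticePoint w - latticePoint v)
  have hs : ∀ p, s (s p) = p := lineReflection_involutive _ _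
  have h₁ : ∀ p ∈ Set.range latticePoint, s p ∈ Set.range latticePoint := by
    rintro _ ⟨z, rfl⟩
    obtain ⟨z', hz, -⟩ := exists_lineReflection_latticePoint h z
    exact ⟨z', hz.symm⟩
  have h₂ : ∀ p ∈ latticeClass c, s p ∈ latticeClass c := by
    rintro _ ⟨z, rfl, hc⟩
    obtain ⟨z', hz, hz'⟩ := exists_lineReflection_latticePoint h z
    exact ⟨z', hz, hz' c hc⟩
  exact fun p ↦ ⟨⟨fun hp ↦ hs p ▸ h₁ _ hp, h₁ p⟩, ⟨fun hp ↦ hs p ▸ h₂ _ hp, h₂ p⟩⟩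

lemma exists_eq_two_pow_smul (u : ℤ × ℤ) (hu : u ≠ 0) :
    ∃ (k : ℕ) (w : ℤ × ℤ), u = ((2 : ℤ) ^ k * w.1, (2 : ℤ) ^ k * w.2) ∧ ¬ (2 ∣ w.1 ∧ 2 ∣ w.2) := by
  induction h : u.1.natAbs + u.2.natAbs using Nat.strong_induction_on generalizing u with
  | _ m ih =>
    by_cases hd : 2 ∣ u.1 ∧ 2 ∣ u.2
    · obtain ⟨⟨a, ha⟩, ⟨b, hb⟩⟩ := hd
      have hne : (a, b) ≠ (0 : ℤ × ℤ) := by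
        rintro h0
        obtain ⟨rfl, rfl⟩ := Prod.mk.inj h0
        exact hu (Prod.ext (by simpa using ha) (by simpa using hb))
      have hlt : a.natAbs + b.natAbs < m := by
        have : a ≠ 0 ∨ b ≠ 0 := by
          by_contra! h0
          exact hne (Prod.ext h0.1 h0.2)
        omega
      obtain ⟨k, w, hw, hw'⟩ := ih _ hlt (a, b) hne rfl
      obtain ⟨rfl, rfl⟩ := Prod.mk.inj hw
      exact ⟨k + 1, w, Prod.ext (by rw [ha]; ring) (by rw [hb]; ring), hw'⟩
    · exact ⟨0, u, by simp, hd⟩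

/-- Between two points of class `c` there is a lattice point of another class. -/
lemma exists_between_latticeClass {c : ℤ} {p q : Plane} (hp : p ∈ latticeClass c)
    (hq : q ∈ latticeClass c) (hpq : p ≠ q) :
    ∃ r : ℝ, 0 < r ∧ r < 1 ∧ p + r • (q - p) ∈ Set.range latticePoint ∧
      p + r • (q - p) ∉ latticeClass c := by
  obtain ⟨z, rfl, hz₁, hz₂⟩ := hp
  obtain ⟨z', rfl, hz'₁, hz'₂⟩ := hq
  obtain ⟨k, w, hw, hw'⟩ := exists_eq_two_pow_smul (z' - z) (sub_ne_zero.2 fun h ↦ hpq (by rw [h]))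
  have e₁ : z'.1 - z.1 = 2 ^ k * w.1 := congrArg Prod.fst hw
  have e₂ : z'.2 - z.2 = 2 ^ k * w.2 := congrArg Prod.snd hw
  -- For `k = 0` the vector `w` would be the whole difference, which is even in both coordinates.
  have hk : k ≠ 0 := by
    rintro rfl
    simp only [Int.ModEq] at *
    omega
  have hpow : (2 : ℝ) ^ k ≠ 0 := by positivity
  have hM : latticePoint z + ((2 : ℝ) ^ k)⁻¹ • (latticePoint z' - latticePoint z) =
      latticePoint (z + w) := by
    have e₁' : (z'.1 : ℝ) - z.1 = 2 ^ k * w.1 := by exact_mod_cast e₁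
    have e₂' : (z'.2 : ℝ) - z.2 = 2 ^ k * w.2 := by exact_mod_cast e₂
    apply plane_ext
    · simp [e₁', hpow]
    · simp [e₂', hpow]
  refine ⟨((2 : ℝ) ^ k)⁻¹, by positivity, inv_lt_one_of_one_lt₀ (one_lt_pow₀ (by norm_num) hk),
    ⟨_, hM.symm⟩, ?_⟩
  rw [hM]
  rintro ⟨y, hy, hy₁, hy₂⟩
  rw [← latticePoint_injective hy] at hy₁ hy₂
  simp only [Int.ModEq, Prod.fst_add, Prod.snd_add] at *
  omega

/-! ### Unfolding billiard trajectories -/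

lemma add_smul_mem_openSegment {p d : Plane} {t u τ : ℝ} (h₁ : t < τ) (h₂ : τ < u) :
    p + τ • d ∈ openSegment ℝ (p + t • d) (p + u • d) := by
  have h : u - t ≠ 0 := by linarith
  refine ⟨(u - τ) / (u - t), (τ - t) / (u - t), div_pos (by linarith) (by linarith),
    div_pos (by linarith) (by linarith), by field_simp; ring, ?_⟩
  have e₁ : (u - τ) / (u - t) = 1 - (τ - t) / (u - t) := by field_simp; ring
  have e₂ : τ = t + (τ - t) / (u - t) * (u - t) := by field_simp; ring
  rw [e₁]
  generalize (τ - t) / (u - t) = r at e₂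
  rw [e₂]
  module

/-- If all edges of the table are edges of the tiling and all lattice points in the table of classes
other than `c` are vertices, then no billiard trajectory joins two points of class `c`. -/
theorem not_illuminates_of_latticeClass {n : ℕ} {P : Polygon Plane n} {Q : Set Plane} {c : ℤ}
    {v : Fin n → ℤ × ℤ} (hv : ∀ j, P j = latticePoint (v j))
    (hedge : ∀ j, IsTileEdge (v j) (v (finRotate n j)))
    (hQ : ∀ z : ℤ × ℤ, latticePoint z ∈ Q → latticePoint z ∉ latticeClass c → ∃ j, z = v j)
    {A B : Plane} (hA : A ∈ latticeClass c) (hB : B ∈ latticeClass c) : ¬ Illuminates P Q A B := by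
  rintro ⟨k, x, hk, ⟨hne, hseg, hb⟩, rfl, rfl⟩
  have hopen : ∀ i < k, ∀ p ∈ openSegment ℝ (x i) (x (i + 1)), p ∈ Set.range latticePoint →
      p ∈ latticeClass c := by
    rintro i hi _ hp ⟨z, rfl⟩
    by_contra hc
    obtain ⟨hpQ, hpv⟩ := hseg i hi hp
    obtain ⟨j, rfl⟩ := hQ z hpQ hc
    exact hpv ⟨j, hv j⟩
  -- Along a tile edge some coordinate changes by exactly 1, so it is not an integer inside the
  -- edge.
  have hbreak : ∀ j, ∀ p ∈ openSegment ℝ (P j) (P (finRotate n j)),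
      p ∉ Set.range latticePoint := by
    rintro j _ hp ⟨z, rfl⟩
    rw [hv, hv] at hp
    obtain ⟨r, r', hr, hr', hrr, e⟩ := hp
    have e₀ := congrArg (· 0) e
    have e₁ := congrArg (· 1) e
    simp only [PiLp.add_apply, PiLp.smul_apply, latticePoint_zero, latticePoint_one,
      smul_eq_mul] at e₀ e₁
    obtain rfl : r = 1 - r' := by linarith
    have hlt : ∀ m : ℤ, (m : ℝ) = r' ∨ (m : ℝ) = -r' → False := by
      rintro m (h | h)
      · have h₁ : (0 : ℝ) < m := by linarith
        have h₂ : (m : ℝ) < 1 := by linarith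
        norm_cast at h₁ h₂
        omega
      · have h₁ : (-1 : ℝ) < m := by linarith
        have h₂ : (m : ℝ) < 0 := by linarith
        norm_cast at h₁ h₂
        omega
    have habs : ∀ a b m : ℤ, |b - a| = 1 → (1 - r') * (a : ℝ) + r' * b = m → False := by
      intro a b m hab h
      rw [abs_eq (by norm_num)] at hab
      apply hlt (m - a)
      rcases hab with hab | hab
      · obtain rfl : b = a + 1 := by linarith
        left; push_cast at *; linarith
      · obtain rfl : b = a - 1 := by linarith
        right; push_cast at *; linarith
    rcases hedge j with ⟨-, h⟩ | ⟨-, h⟩ | ⟨h, -⟩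
    · exact habs _ _ _ h e₁
    · exact habs _ _ _ h e₀
    · exact habs _ _ _ h e₀
  -- `g` unfolds the leg from `x i` to `x (i + 1)` onto the ray of the first leg, where it occupies
  -- the parameters from `t` to `t + r`. The invariant is that the ray meets no lattice point
  -- outside class `c` up to there.
  have main : ∀ i < k, ∃ g : Plane ≃ᵃ[ℝ] Plane, PreservesLattice c g ∧ ∃ t r : ℝ, 0 ≤ t ∧ 0 < r ∧
      g (x i) = x 0 + t • (x 1 - x 0) ∧ g (x (i + 1)) = x 0 + (t + r) • (x 1 - x 0) ∧
      ∀ τ : ℝ, 0 < τ → τ < t + r → x 0 + τ • (x 1 - x 0) ∈ Set.range latticePoint →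
        x 0 + τ • (x 1 - x 0) ∈ latticeClass c := by
    have hmid : ∀ i < k, ∀ g : Plane ≃ᵃ[ℝ] Plane, PreservesLattice c g → ∀ t r : ℝ,
        g (x i) = x 0 + t • (x 1 - x 0) → g (x (i + 1)) = x 0 + (t + r) • (x 1 - x 0) →
        ∀ τ : ℝ, t < τ → τ < t + r → x 0 + τ • (x 1 - x 0) ∈ Set.range latticePoint →
        x 0 + τ • (x 1 - x 0) ∈ latticeClass c := by
      intro i hi g hg t r h₁ h₂ τ hτ₁ hτ₂ hτ
      have := add_smul_mem_openSegment (p := x 0) (d := x 1 - x 0) hτ₁ hτ₂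
      rw [← h₁, ← h₂, ← AffineEquiv.coe_toAffineMap, ← image_openSegment] at this
      obtain ⟨z, hz, hz'⟩ := this
      rw [← hz'] at hτ ⊢
      exact (hg z).2.2 (hopen i hi z hz ((hg z).1.1 hτ))
    intro i
    induction i with
    | zero =>
      intro _
      have h₀ : AffineEquiv.refl ℝ Plane (x 0) = x 0 + (0 : ℝ) • (x 1 - x 0) := by simp
      have h₁ : AffineEquiv.refl ℝ Plane (x 1) = x 0 + (0 + 1 : ℝ) • (x 1 - x 0) := by simp
      have hg : PreservesLattice c (AffineEquiv.refl ℝ Plane) := fun p ↦ by simp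
      exact ⟨_, hg, 0, 1, le_rfl, one_pos, h₀, h₁, hmid 0 hk _ hg _ _ h₀ h₁⟩
    | succ i ih =>
      intro hi
      obtain ⟨g, hg, t, r, ht, hr, h₁, h₂, hblock⟩ := ih (by omega)
      obtain ⟨j, hj, hray⟩ := hb i hi
      -- The reflected next leg continues the present one straight on; `ρ` is the ratio of their
      -- lengths.
      obtain ⟨ρ, hρ, hρe⟩ : ∃ ρ : ℝ, 0 < ρ ∧ (Submodule.span ℝ {P (finRotate n j) - P j}).reflection
          (x (i + 2) - x (i + 1)) = ρ • (x (i + 1) - x i) := by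
        have hw : x (i + 2) - x (i + 1) ≠ 0 := sub_ne_zero.2 (hne (i + 1) hi).symm
        have hu : (Submodule.span ℝ {P (finRotate n j) - P j}).reflection
            (x (i + 1) - x i) ≠ 0 := by
          rw [Ne, LinearIsometryEquiv.map_eq_zero_iff]
          exact sub_ne_zero.2 (hne i (by omega)).symm
        obtain ⟨ρ, hρ, h⟩ := hray.exists_pos_left hu hw
        refine ⟨ρ, hρ, ?_⟩
        rw [← h, map_smul, Submodule.reflection_reflection]
      set s := lineReflection (P j) (P (finRotate n j) - P j) with hs
      have hsg : PreservesLattice c s := by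
        rw [hs, hv, hv]; exact preservesLattice_lineReflection c (hedge j)
      have hfix : s (x (i + 1)) = x (i + 1) := by
        obtain ⟨θ, -, hθ⟩ := openSegment_eq_image_lineMap ℝ (P j) _ ▸ hj
        rw [← hθ]
        exact lineReflection_lineMap _ _ _
      have hg' : PreservesLattice c (s.trans g) := fun p ↦
        ⟨(hg (s p)).1.trans (hsg p).1, (hg (s p)).2.trans (hsg p).2⟩
      have k₁ : (s.trans g) (x (i + 1)) = x 0 + (t + r) • (x 1 - x 0) := by
        rw [AffineEquiv.trans_apply, hfix, h₂]
      have hlin : ∀ p q, g p - g q = g.linear (p - q) := fun p q ↦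
        (AffineMap.linearMap_vsub g.toAffineMap p q).symm
      have k₂ : (s.trans g) (x (i + 2)) = x 0 + (t + r + ρ * r) • (x 1 - x 0) := by
        have e : g (s (x (i + 2))) - g (s (x (i + 1))) = ρ • (g (x (i + 1)) - g (x i)) := by
          rw [hlin, hlin, hs, lineReflection_sub, hρe, map_smul]
        rw [AffineEquiv.trans_apply, ← sub_add_cancel (g (s (x (i + 2)))) (g (s (x (i + 1)))), e,
          hfix, h₁, h₂]
        module
      refine ⟨s.trans g, hg', t + r, ρ * r, by positivity, by positivity, k₁, k₂, ?_⟩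
      intro τ hτ hτ' hM
      -- Earlier legs are covered by induction, the break point is no lattice point, and the new leg
      -- is covered by `hmid`.
      rcases lt_trichotomy τ (t + r) with h | rfl | h
      · exact hblock τ hτ h hM
      · rw [← h₂] at hM
        exact absurd ((hg _).1.1 hM) (hbreak j _ hj)
      · exact hmid (i + 1) hi _ hg' _ _ k₁ k₂ τ h hτ' hM
  obtain ⟨g, hg, t, r, ht, hr, -, h₂, hblock⟩ := main (k - 1) (by omega)
  rw [Nat.sub_add_cancel hk] at h₂
  -- `A = B` is allowed, but the unfolded end points differ because the path has positive length.
  have hne' : x 0 ≠ g (x k) := by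
    rw [h₂]
    intro h
    rw [left_eq_add, smul_eq_zero, sub_eq_zero] at h
    rcases h with h | h
    · linarith
    · exact hne 0 hk h.symm
  obtain ⟨q, hq₀, hq₁, hq, hq'⟩ := exists_between_latticeClass hA ((hg _).2.2 hB) hne'
  have e : x 0 + q • (g (x k) - x 0) = x 0 + (q * (t + r)) • (x 1 - x 0) := by
    rw [h₂]; module
  rw [e] at hq hq'
  exact hq' (hblock _ (by positivity) (by nlinarith) hq)

/-! ### Open pieces made of adjacent tiles -/

namespace Tile

lemma convex_closedInterior (τ : Tile) : Convex ℝ τ.triangle.closedInterior := by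
  intro p hp q hq u v hu hv huv
  rw [mem_closedInterior_iff] at *
  rw [alpha_combo _ _ _ huv, beta_combo _ _ _ huv]
  obtain rfl : u = 1 - v := by linarith
  refine ⟨?_, ?_, ?_⟩ <;> nlinarith

lemma isOpen_interior (τ : Tile) : IsOpen τ.triangle.interior := by
  have : τ.triangle.interior = {p | 0 < τ.beta p} ∩ {p | τ.beta p < τ.alpha p} ∩
      {p | τ.alpha p < 1} := by
    ext p; simp [mem_interior_iff, and_assoc]
  rw [this]
  exact ((isOpen_lt (by fun_prop) (by fun_prop)).inter (isOpen_lt (by fun_prop) (by fun_prop))).inter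
    (isOpen_lt (by fun_prop) (by fun_prop))

lemma latticePoint_vert_mem (τ : Tile) (l : Fin 3) :
    latticePoint (τ.vert l) ∈ τ.triangle.closedInterior :=
  τ.triangle.point_mem_closedInterior l

/-- The open square made up of the eight tiles around the even point `(2 * a, 2 * b)`. -/
def star (a b : ℤ) : Set Plane := {p | |p 0 - 2 * a| < 1 ∧ |p 1 - 2 * b| < 1}

/-- The interior of the union of a tile and its mirror image in the side opposite to vertex `0`. -/
def double (τ : Tile) : Set Plane :=
  {p | 0 < τ.beta p ∧ τ.beta p < τ.alpha p ∧ τ.alpha p + τ.beta p < 2}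

/-- The interior of the union of a tile and its mirror image in its hypotenuse. -/
def corner (τ : Tile) : Set Plane :=
  {p | (0 < τ.alpha p ∧ τ.alpha p < 1) ∧ 0 < τ.beta p ∧ τ.beta p < 1}

lemma isOpen_star (a b : ℤ) : IsOpen (star a b) := by
  unfold star
  exact (isOpen_lt (by fun_prop) (by fun_prop)).and (isOpen_lt (by fun_prop) (by fun_prop))

lemma isOpen_double (τ : Tile) : IsOpen τ.double := by
  unfold double
  exact (isOpen_lt (by fun_prop) (by fun_prop)).and
    ((isOpen_lt (by fun_prop) (by fun_prop)).and (isOpen_lt (by fun_prop) (by fun_prop)))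

lemma isOpen_corner (τ : Tile) : IsOpen τ.corner := by
  unfold corner
  exact ((isOpen_lt (by fun_prop) (by fun_prop)).and (isOpen_lt (by fun_prop) (by fun_prop))).and
    ((isOpen_lt (by fun_prop) (by fun_prop)).and (isOpen_lt (by fun_prop) (by fun_prop)))

lemma combo_lt_combo {u v x y x' y' : ℝ} (hu : 0 ≤ u) (hv : 0 ≤ v) (h : u + v = 1) (hx : x < x')
    (hy : y < y') : u * x + v * y < u * x' + v * y' := by
  rcases hv.eq_or_lt with rfl | hv
  · obtain rfl : u = 1 := by linarith
    linarith
  · nlinarith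

lemma isPreconnected_star (a b : ℤ) : IsPreconnected (star a b) := by
  refine Convex.isPreconnected fun p hp q hq u v hu hv huv ↦ ?_
  simp only [star, Set.mem_ofPred_eq, abs_lt, PiLp.add_apply, PiLp.smul_apply, smul_eq_mul] at *
  have h₁ := combo_lt_combo hu hv huv hp.1.1 hq.1.1
  have h₂ := combo_lt_combo hu hv huv hp.1.2 hq.1.2
  have h₃ := combo_lt_combo hu hv huv hp.2.1 hq.2.1
  have h₄ := combo_lt_combo hu hv huv hp.2.2 hq.2.2
  obtain rfl : u = 1 - v := by linarith
  refine ⟨⟨?_, ?_⟩, ?_, ?_⟩ <;> linarith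

lemma isPreconnected_double (τ : Tile) : IsPreconnected τ.double := by
  refine Convex.isPreconnected fun p hp q hq u v hu hv huv ↦ ?_
  simp only [double, Set.mem_ofPred_eq, alpha_combo _ _ _ huv, beta_combo _ _ _ huv] at *
  have h₁ := combo_lt_combo hu hv huv hp.1 hq.1
  have h₂ := combo_lt_combo hu hv huv hp.2.1 hq.2.1
  have h₃ := combo_lt_combo hu hv huv hp.2.2 hq.2.2
  refine ⟨?_, ?_, ?_⟩ <;> linarith

lemma isPreconnected_corner (τ : Tile) : IsPreconnected τ.corner := by
  refine Convex.isPreconnected fun p hp q hq u v hu hv huv ↦ ?_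
  simp only [corner, Set.mem_ofPred_eq, alpha_combo _ _ _ huv, beta_combo _ _ _ huv] at *
  have h₁ := combo_lt_combo hu hv huv hp.1.1 hq.1.1
  have h₂ := combo_lt_combo hu hv huv hp.1.2 hq.1.2
  have h₃ := combo_lt_combo hu hv huv hp.2.1 hq.2.1
  have h₄ := combo_lt_combo hu hv huv hp.2.2 hq.2.2
  refine ⟨⟨?_, ?_⟩, ?_, ?_⟩ <;> linarith

lemma alpha_mirror_one (τ : Tile) (p : Plane) : (τ.mirror 1).alpha p = τ.beta p := by
  obtain ⟨a, b, s, t, w⟩ := τ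
  cases w <;> simp [mirror, alpha, beta]

lemma beta_mirror_one (τ : Tile) (p : Plane) : (τ.mirror 1).beta p = τ.alpha p := by
  obtain ⟨a, b, s, t, w⟩ := τ
  cases w <;> simp [mirror, alpha, beta]

lemma alpha_mirror_two (τ : Tile) (p : Plane) : (τ.mirror 2).alpha p = 2 - τ.alpha p := by
  obtain ⟨a, b, s, t, w⟩ := τ
  cases w <;> cases s <;> cases t <;> simp [mirror, alpha, boolSign] <;> ring

lemma beta_mirror_two (τ : Tile) (p : Plane) : (τ.mirror 2).beta p = τ.beta p := by
  obtain ⟨a, b, s, t, w⟩ := τ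
  cases w <;> simp [mirror, beta]

lemma double_mirror_two (τ : Tile) : (τ.mirror 2).double = τ.double := by
  ext p
  simp only [double, Set.mem_ofPred_eq, alpha_mirror_two, beta_mirror_two]
  constructor <;> rintro ⟨_, _, _⟩ <;> refine ⟨?_, ?_, ?_⟩ <;> linarith

lemma corner_mirror_one (τ : Tile) : (τ.mirror 1).corner = τ.corner := by
  ext p
  simp only [corner, Set.mem_ofPred_eq, alpha_mirror_one, beta_mirror_one, and_comm]

lemma double_subset (τ : Tile) :
    τ.double ⊆ τ.triangle.closedInterior ∪ (τ.mirror 2).triangle.closedInterior := by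
  rintro p ⟨h₀, h₁, h₂⟩
  simp only [Set.mem_union, mem_closedInterior_iff, alpha_mirror_two, beta_mirror_two]
  rcases le_total (τ.alpha p) 1 with h | h
  · left; refine ⟨?_, ?_, ?_⟩ <;> linarith
  · right; refine ⟨?_, ?_, ?_⟩ <;> linarith

lemma corner_subset (τ : Tile) :
    τ.corner ⊆ τ.triangle.closedInterior ∪ (τ.mirror 1).triangle.closedInterior := by
  rintro p ⟨⟨h₀, h₁⟩, h₂, h₃⟩
  simp only [Set.mem_union, mem_closedInterior_iff, alpha_mirror_one, beta_mirror_one]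
  rcases le_total (τ.beta p) (τ.alpha p) with h | h
  · left; refine ⟨?_, ?_, ?_⟩ <;> linarith
  · right; refine ⟨?_, ?_, ?_⟩ <;> linarith

lemma exists_tile_of_mem_star {a b : ℤ} {p : Plane} (hp : p ∈ star a b) :
    ∃ s t w, p ∈ (⟨a, b, s, t, w⟩ : Tile).triangle.closedInterior := by
  have h : ∀ x : ℝ, |x| < 1 → ∃ s : Bool, 0 ≤ boolSign s * x ∧ boolSign s * x ≤ 1 := by
    intro x hx
    rw [abs_lt] at hx
    rcases le_total 0 x with h | h
    · exact ⟨true, by simpa [boolSign] using ⟨h, hx.2.le⟩⟩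
    · exact ⟨false, by simp [boolSign]; constructor <;> linarith⟩
  obtain ⟨s, hs, hs'⟩ := h _ hp.1
  obtain ⟨t, ht, ht'⟩ := h _ hp.2
  rcases le_total (boolSign t * (p 1 - 2 * b) : ℝ) (boolSign s * (p 0 - 2 * a)) with h | h
  · exact ⟨s, t, false, by simpa [mem_closedInterior_iff, alpha, beta] using ⟨ht, h, hs'⟩⟩
  · exact ⟨s, t, true, by simpa [mem_closedInterior_iff, alpha, beta] using ⟨hs, h, ht'⟩⟩

lemma mem_star_of_alpha_lt_one {τ : Tile} {p : Plane} (hp : p ∈ τ.triangle.closedInterior)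
    (h : τ.alpha p < 1) : p ∈ star τ.a τ.b := by
  rw [mem_closedInterior_iff] at hp
  obtain ⟨a, b, s, t, w⟩ := τ
  obtain ⟨h₀, h₁, -⟩ := hp
  simp only [star, Set.mem_ofPred_eq, abs_lt]
  cases s <;> cases t <;> cases w <;> simp [alpha, beta, boolSign] at * <;>
    refine ⟨⟨?_, ?_⟩, ?_, ?_⟩ <;> linarith

lemma eq_lineMap_of_beta_eq_zero {τ : Tile} {p : Plane} (h : τ.beta p = 0) :
    p = AffineMap.lineMap (latticePoint (τ.vert 0)) (latticePoint (τ.vert 1)) (τ.alpha p) := by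
  conv_lhs => rw [← τ.point_alpha_beta p, h]
  generalize τ.alpha p = x
  clear h
  obtain ⟨a, b, s, t, w⟩ := τ
  cases w <;> apply plane_ext <;> simp [point, vert, AffineMap.lineMap_apply, mul_comm, add_comm]

lemma eq_lineMap_of_beta_eq_alpha {τ : Tile} {p : Plane} (h : τ.beta p = τ.alpha p) :
    p = AffineMap.lineMap (latticePoint (τ.vert 0)) (latticePoint (τ.vert 2)) (τ.alpha p) := by
  conv_lhs => rw [← τ.point_alpha_beta p, h]
  generalize τ.alpha p = x
  clear h
  obtain ⟨a, b, s, t, w⟩ := τ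
  cases w <;> apply plane_ext <;> simp [point, vert, AffineMap.lineMap_apply, mul_comm, add_comm]

lemma eq_lineMap_of_alpha_eq_one {τ : Tile} {p : Plane} (h : τ.alpha p = 1) :
    p = AffineMap.lineMap (latticePoint (τ.vert 1)) (latticePoint (τ.vert 2)) (τ.beta p) := by
  conv_lhs => rw [← τ.point_alpha_beta p, h]
  generalize τ.beta p = x
  clear h
  obtain ⟨a, b, s, t, w⟩ := τ
  cases w <;> apply plane_ext <;> simp [point, vert, AffineMap.lineMap_apply, mul_comm, add_comm]

end Tile

/-! ### The chain, the tiled region and its connectedness -/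

/-- If a linear form separates two segments and is not constant on either of them, then they meet at
most in a common end point. -/
lemma mem_endpoints_of_separated (a b : ℤ) {v w v' w' : ℤ × ℤ} {p : Plane}
    (hvw : a * v.1 + b * v.2 ≠ a * w.1 + b * w.2)
    (hvw' : a * v'.1 + b * v'.2 ≠ a * w'.1 + b * w'.2)
    (h₁ : a * v.1 + b * v.2 ≤ a * v'.1 + b * v'.2) (h₂ : a * v.1 + b * v.2 ≤ a * w'.1 + b * w'.2)
    (h₃ : a * w.1 + b * w.2 ≤ a * v'.1 + b * v'.2) (h₄ : a * w.1 + b * w.2 ≤ a * w'.1 + b * w'.2)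
    (hp : p ∈ affineSegment ℝ (latticePoint v) (latticePoint w))
    (hp' : p ∈ affineSegment ℝ (latticePoint v') (latticePoint w')) :
    p ∈ ({latticePoint v, latticePoint w} ∩ {latticePoint v', latticePoint w'} : Set Plane) := by
  obtain ⟨r, ⟨hr₀, hr₁⟩, rfl⟩ := hp
  obtain ⟨r', ⟨hr₀', hr₁'⟩, e⟩ := hp'
  have e₀ := congrArg (· 0) e
  have e₁ := congrArg (· 1) e
  simp only [AffineMap.lineMap_apply, vsub_eq_sub, vadd_eq_add, PiLp.add_apply, PiLp.smul_apply,
    PiLp.sub_apply, latticePoint_zero, latticePoint_one, smul_eq_mul] at e₀ e₁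
  have e₂ : r' * ((a * w'.1 + b * w'.2) - (a * v'.1 + b * v'.2)) + (a * v'.1 + b * v'.2) =
      r * ((a * w.1 + b * w.2) - (a * v.1 + b * v.2)) + (a * v.1 + b * v.2 : ℝ) := by
    linear_combination (a : ℝ) * e₀ + b * e₁
  -- At a common point the form attains its maximum on the first segment and its minimum on the
  -- second; being nonconstant on both, it does so only at end points.
  have key : ∀ {x y x' y' : ℤ}, x ≠ y → x' ≠ y' → x ≤ x' → x ≤ y' → y ≤ x' → y ≤ y' →
      r' * (y' - x') + x' = r * (y - x) + (x : ℝ) → (r = 0 ∨ r = 1) ∧ (r' = 0 ∨ r' = 1) := by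
    intro x y x' y' hxy hxy' h₁ h₂ h₃ h₄ e
    have g₁ : (x : ℝ) ≤ x' := by exact_mod_cast h₁
    have g₂ : (x : ℝ) ≤ y' := by exact_mod_cast h₂
    have g₃ : (y : ℝ) ≤ x' := by exact_mod_cast h₃
    have g₄ : (y : ℝ) ≤ y' := by exact_mod_cast h₄
    constructor
    · rcases hxy.lt_or_gt with h | h
      · have h : (x : ℝ) < y := by exact_mod_cast h
        right; nlinarith
      · have h : (y : ℝ) < x := by exact_mod_cast h
        left; nlinarith
    · rcases hxy'.lt_or_gt with h | h
      · have h : (x' : ℝ) < y' := by exact_mod_cast h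
        left; nlinarith
      · have h : (y' : ℝ) < x' := by exact_mod_cast h
        right; nlinarith
  obtain ⟨hr, hr'⟩ := key hvw hvw' h₁ h₂ h₃ h₄ (by push_cast; exact e₂)
  constructor
  · rcases hr with rfl | rfl <;> simp
  · rw [← e]; rcases hr' with rfl | rfl <;> simp

/-- The vertices of the chain with 22 edges; it passes twice through `(0, 2)`. -/
def chain : Fin 22 → ℤ × ℤ :=
  ![(0, -2), (1, -1), (1, 0), (2, 0), (2, 1), (3, 1), (4, 2), (3, 2), (3, 3), (2, 4), (2, 3),
    (1, 3), (0, 2), (1, 2), (1, 1), (0, 1), (0, 2), (-1, 1), (-1, 0), (-2, 0), (-1, -1), (0, -1)]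

/-- The tiles of the polygon: the eight tiles around `(0, 0)`, two tiles around `(2, 0)`, the eight
tiles around `(2, 2)`, and six outer tiles. -/
def tiles : Fin 24 → Tile :=
  ![⟨0, 0, true, true, false⟩, ⟨0, 0, true, true, true⟩, ⟨0, 0, false, true, true⟩,
    ⟨0, 0, false, true, false⟩, ⟨0, 0, false, false, false⟩, ⟨0, 0, false, false, true⟩,
    ⟨0, 0, true, false, true⟩, ⟨0, 0, true, false, false⟩, ⟨1, 0, false, true, false⟩,
    ⟨1, 0, false, true, true⟩, ⟨1, 1, false, false, true⟩, ⟨1, 1, false, false, false⟩,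
    ⟨1, 1, false, true, false⟩, ⟨1, 1, false, true, true⟩, ⟨1, 1, true, true, true⟩,
    ⟨1, 1, true, true, false⟩, ⟨1, 1, true, false, false⟩, ⟨1, 1, true, false, true⟩,
    ⟨0, 1, false, false, true⟩, ⟨-1, 0, true, false, false⟩, ⟨0, -1, true, true, true⟩,
    ⟨0, 1, true, true, false⟩, ⟨2, 1, false, false, false⟩, ⟨1, 2, true, false, true⟩]

/-- The tiles around `(0, 0)` whose mirror image in the side opposite to `(0, 0)` is in the
polygon. -/
def firstWing : Fin 4 → Tile :=
  ![⟨0, 0, true, true, false⟩, ⟨0, 0, false, true, true⟩, ⟨0, 0, false, false, false⟩,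
    ⟨0, 0, true, false, true⟩]

/-- The tiles around `(2, 2)` whose mirror image in the side opposite to `(2, 2)` is in the
polygon. -/
def secondWing : Fin 4 → Tile :=
  ![⟨1, 1, false, false, true⟩, ⟨1, 1, false, true, false⟩, ⟨1, 1, true, true, true⟩,
    ⟨1, 1, true, false, false⟩]

/-- The closed polygonal chain with vertices `chain`. -/
noncomputable def chainPolygon : Polygon Plane 22 := ⟨fun j ↦ latticePoint (chain j)⟩

/-- The polygon tiled by `tiles`. -/
def tiledRegion : Set Plane := ⋃ i, (tiles i).triangle.closedInterior

/-- The tile at `(2, 0)` that connects the two squares, together with its mirror image. -/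
def bridge : Tile := ⟨1, 0, false, true, false⟩

/-- An open square around an even point with its wings. -/
def winged (a b : ℤ) (d : Fin 4 → Tile) : Set Plane := ⋃ k, Tile.star a b ∪ (d k).double

/-- The interior of the polygon. -/
def openRegion : Set Plane := winged 0 0 firstWing ∪ bridge.corner ∪ winged 1 1 secondWing

lemma isOpen_winged (a b : ℤ) (d : Fin 4 → Tile) : IsOpen (winged a b d) :=
  isOpen_iUnion fun _ ↦ (Tile.isOpen_star _ _).union (Tile.isOpen_double _)

lemma isOpen_openRegion : IsOpen openRegion :=
  ((isOpen_winged _ _ _).union (Tile.isOpen_corner _)).union (isOpen_winged _ _ _)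

/-- Each double meets the square in the barycentre of its inner tile. Repeating the square in every
member of the union makes all members share its centre. -/
lemma isPreconnected_winged {a b : ℤ} {d : Fin 4 → Tile} (h : ∀ k, (d k).a = a ∧ (d k).b = b) :
    IsPreconnected (winged a b d) := by
  refine isPreconnected_iUnion ⟨latticePoint (2 * a, 2 * b), Set.mem_iInter.2 fun k ↦ Or.inl ?_⟩
    fun k ↦ IsPreconnected.union ((d k).point (2 / 3) (1 / 3)) ?_ ?_ (Tile.isPreconnected_star _ _)
      (Tile.isPreconnected_double _)
  · simp [Tile.star]
  · rw [← (h k).1, ← (h k).2]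
    apply Tile.mem_star_of_alpha_lt_one
    · rw [Tile.mem_closedInterior_iff]; norm_num
    · norm_num
  · simp only [Tile.double, Set.mem_ofPred_eq, Tile.alpha_point, Tile.beta_point]; norm_num

/-- The unit square at the corner `(2, 0)` overlaps one wing of each large square: the two tiles of
the bridge are the outer halves of `firstWing 0` and `secondWing 0`. -/
lemma isPreconnected_openRegion : IsPreconnected openRegion := by
  have h : ∀ τ : Tile, τ.point (2 / 3) (1 / 3) ∈ τ.corner := fun τ ↦ by
    simp only [Tile.corner, Set.mem_ofPred_eq, Tile.alpha_point, Tile.beta_point]; norm_num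
  have h' : ∀ τ : Tile, τ.point (2 / 3) (1 / 3) ∈ τ.double := fun τ ↦ by
    simp only [Tile.double, Set.mem_ofPred_eq, Tile.alpha_point, Tile.beta_point]; norm_num
  refine IsPreconnected.union ((bridge.mirror 1).point (2 / 3) (1 / 3)) (Or.inr ?_) ?_
    (IsPreconnected.union (bridge.point (2 / 3) (1 / 3)) ?_ (h _)
      (isPreconnected_winged (by decide)) (Tile.isPreconnected_corner _))
    (isPreconnected_winged (by decide))
  · rw [← Tile.corner_mirror_one]; exact h _
  · refine Set.mem_iUnion.2 ⟨0, Or.inr ?_⟩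
    have := h' (bridge.mirror 1)
    rwa [← Tile.double_mirror_two, show (bridge.mirror 1).mirror 2 = secondWing 0 by decide] at this
  · refine Set.mem_iUnion.2 ⟨0, Or.inr ?_⟩
    have := h' bridge
    rwa [← Tile.double_mirror_two, show bridge.mirror 2 = firstWing 0 by decide] at this

lemma closedInterior_subset_tiledRegion {τ : Tile} (h : ∃ i, tiles i = τ) :
    τ.triangle.closedInterior ⊆ tiledRegion := by
  obtain ⟨i, rfl⟩ := h
  exact Set.subset_iUnion (fun i ↦ (tiles i).triangle.closedInterior) i

lemma winged_subset {a b : ℤ} {d : Fin 4 → Tile} (h : ∀ s t w, ∃ i, tiles i = ⟨a, b, s, t, w⟩)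
    (h₁ : ∀ k, ∃ i, tiles i = d k) (h₂ : ∀ k, ∃ i, tiles i = (d k).mirror 2) :
    winged a b d ⊆ tiledRegion := by
  refine Set.iUnion_subset fun k ↦ Set.union_subset (fun p hp ↦ ?_) ?_
  · obtain ⟨s, t, w, hp⟩ := Tile.exists_tile_of_mem_star hp
    exact closedInterior_subset_tiledRegion (h s t w) hp
  · exact (Tile.double_subset _).trans (Set.union_subset
      (closedInterior_subset_tiledRegion (h₁ k)) (closedInterior_subset_tiledRegion (h₂ k)))

lemma openRegion_subset : openRegion ⊆ tiledRegion := by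
  refine Set.union_subset (Set.union_subset ?_ ?_) ?_
  · exact winged_subset (by decide) (by decide) (by decide)
  · exact (Tile.corner_subset _).trans (Set.union_subset
      (closedInterior_subset_tiledRegion (by decide))
      (closedInterior_subset_tiledRegion (by decide)))
  · exact winged_subset (by decide) (by decide) (by decide)

/-! ### Interior and boundary of the region -/

lemma isCompact_tiledRegion : IsCompact tiledRegion :=
  isCompact_iUnion fun i ↦ (tiles i).triangle.isCompact_closedInterior

/-- The segment between two lattice points is an edge of the chain. -/
def IsChainEdge (z w : ℤ × ℤ) : Prop :=
  ∃ j : Fin 22, (chain j = z ∧ chain (j + 1) = w) ∨ (chain j = w ∧ chain (j + 1) = z)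

instance (z w : ℤ × ℤ) : Decidable (IsChainEdge z w) := by unfold IsChainEdge; infer_instance

lemma edgeSet_chainPolygon (j : Fin 22) : chainPolygon.edgeSet ℝ j =
    affineSegment ℝ (latticePoint (chain j)) (latticePoint (chain (j + 1))) := by
  simp [Polygon.edgeSet, chainPolygon]

lemma IsChainEdge.affineSegment_subset {z w : ℤ × ℤ} (h : IsChainEdge z w) :
    affineSegment ℝ (latticePoint z) (latticePoint w) ⊆ chainPolygon.boundary ℝ := by
  obtain ⟨j, ⟨rfl, rfl⟩ | ⟨rfl, rfl⟩⟩ := h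
  · rw [← edgeSet_chainPolygon]
    exact Set.subset_iUnion (fun j ↦ chainPolygon.edgeSet ℝ j) j
  · rw [affineSegment_comm, ← edgeSet_chainPolygon]
    exact Set.subset_iUnion (fun j ↦ chainPolygon.edgeSet ℝ j) j

lemma latticePoint_mem_boundary {z : ℤ × ℤ} (h : ∃ j, chain j = z) :
    latticePoint z ∈ chainPolygon.boundary ℝ := by
  obtain ⟨j, rfl⟩ := h
  refine Set.mem_iUnion.2 ⟨j, ?_⟩
  rw [edgeSet_chainPolygon]
  exact left_mem_affineSegment ..

/-- This settles which sides are walls. A tile around a centre can have a wall only opposite the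
centre. An outer tile is glued to a wing along that side, and its other sides are walls, except for
the hypotenuse shared by the two bridge tiles. -/
lemma tiles_square_or_outer (i : Fin 24) :
    ((((tiles i).a = 0 ∧ (tiles i).b = 0) ∨ ((tiles i).a = 1 ∧ (tiles i).b = 1)) ∧
      (∃ j, chain j = (tiles i).vert 1) ∧ (∃ j, chain j = (tiles i).vert 2) ∧
      (IsChainEdge ((tiles i).vert 1) ((tiles i).vert 2) ∨ (∃ k, firstWing k = tiles i) ∨
        ∃ k, secondWing k = tiles i)) ∨
    (IsChainEdge ((tiles i).vert 0) ((tiles i).vert 1) ∧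
      ((∃ k, firstWing k = (tiles i).mirror 2) ∨ ∃ k, secondWing k = (tiles i).mirror 2) ∧
      (IsChainEdge ((tiles i).vert 0) ((tiles i).vert 2) ∨
        ((∃ j, chain j = (tiles i).vert 0) ∧ (∃ j, chain j = (tiles i).vert 2) ∧
          (tiles i = bridge ∨ (tiles i).mirror 1 = bridge)))) := by
  revert i
  decide +kernel

lemma star_subset_openRegion {a b : ℤ} (h : (a = 0 ∧ b = 0) ∨ (a = 1 ∧ b = 1)) :
    Tile.star a b ⊆ openRegion := by
  rcases h with ⟨rfl, rfl⟩ | ⟨rfl, rfl⟩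
  · exact fun p hp ↦ Or.inl (Or.inl (Set.mem_iUnion.2 ⟨0, Or.inl hp⟩))
  · exact fun p hp ↦ Or.inr (Set.mem_iUnion.2 ⟨0, Or.inl hp⟩)

lemma double_subset_openRegion {τ : Tile}
    (h : (∃ k, firstWing k = τ) ∨ ∃ k, secondWing k = τ) : τ.double ⊆ openRegion := by
  rcases h with ⟨k, rfl⟩ | ⟨k, rfl⟩
  · exact fun p hp ↦ Or.inl (Or.inl (Set.mem_iUnion.2 ⟨k, Or.inr hp⟩))
  · exact fun p hp ↦ Or.inr (Set.mem_iUnion.2 ⟨k, Or.inr hp⟩)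

lemma tiledRegion_subset : tiledRegion ⊆ openRegion ∪ chainPolygon.boundary ℝ := by
  refine Set.iUnion_subset fun i p hp ↦ ?_
  obtain ⟨h₀, h₁, h₂⟩ := Tile.mem_closedInterior_iff.1 hp
  rcases tiles_square_or_outer i with ⟨hab, hv₁, hv₂, he⟩ | ⟨he, hd, hc⟩
  · rcases h₂.lt_or_eq with h₂ | h₂
    · exact Or.inl (star_subset_openRegion hab (Tile.mem_star_of_alpha_lt_one hp h₂))
    · have e := Tile.eq_lineMap_of_alpha_eq_one h₂
      rcases he with he | he
      · exact Or.inr (he.affineSegment_subset ⟨_, ⟨h₀, by linarith⟩, e.symm⟩)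
      · rcases h₀.lt_or_eq with h₀ | h₀
        · rcases h₁.lt_or_eq with h₁ | h₁
          · exact Or.inl (double_subset_openRegion he ⟨h₀, h₁, by linarith⟩)
          · rw [h₁, h₂, AffineMap.lineMap_apply_one] at e
            exact Or.inr (e ▸ latticePoint_mem_boundary hv₂)
        · rw [← h₀, AffineMap.lineMap_apply_zero] at e
          exact Or.inr (e ▸ latticePoint_mem_boundary hv₁)
  · rcases h₀.lt_or_eq with h₀ | h₀
    · rcases h₁.lt_or_eq with h₁ | h₁
      · refine Or.inl (double_subset_openRegion hd ?_)
        rw [Tile.double_mirror_two]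
        exact ⟨h₀, h₁, by linarith⟩
      · have e := Tile.eq_lineMap_of_beta_eq_alpha h₁
        rcases hc with hc | ⟨-, hv₂, hc⟩
        · exact Or.inr (hc.affineSegment_subset ⟨_, ⟨by linarith, h₂⟩, e.symm⟩)
        · rcases h₂.lt_or_eq with h₂ | h₂
          · have hp' : p ∈ (tiles i).corner := ⟨⟨by linarith, h₂⟩, h₀, by linarith⟩
            refine Or.inl (Or.inl (Or.inr ?_))
            rcases hc with hc | hc
            · rwa [hc] at hp'
            · rwa [← Tile.corner_mirror_one, hc] at hp'
          · rw [h₂, AffineMap.lineMap_apply_one] at e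
            exact Or.inr (e ▸ latticePoint_mem_boundary hv₂)
    · exact Or.inr (he.affineSegment_subset
        ⟨_, ⟨by linarith, h₂⟩, (Tile.eq_lineMap_of_beta_eq_zero h₀.symm).symm⟩)

lemma affineSegment_vert_subset (τ : Tile) (l l' : Fin 3) :
    affineSegment ℝ (latticePoint (τ.vert l)) (latticePoint (τ.vert l')) ⊆
      τ.triangle.closedInterior := by
  rw [affineSegment_eq_segment]
  exact τ.convex_closedInterior.segment_subset (τ.latticePoint_vert_mem l)
    (τ.latticePoint_vert_mem l')

/-- Every edge of the chain separates a tile of the polygon from a tile outside it. -/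
lemma exists_tiles_of_chain_edge (j : Fin 22) : ∃ i l l', chain j = (tiles i).vert l ∧
    chain (j + 1) = (tiles i).vert l' ∧ ∃ k, chain j = ((tiles i).mirror k).vert l ∧
      chain (j + 1) = ((tiles i).mirror k).vert l' ∧ ∀ i', tiles i' ≠ (tiles i).mirror k := by
  revert j
  decide +kernel

lemma boundary_subset : chainPolygon.boundary ℝ ⊆ tiledRegion := by
  refine Set.iUnion_subset fun j ↦ ?_
  obtain ⟨i, l, l', h, h', -⟩ := exists_tiles_of_chain_edge j
  rw [edgeSet_chainPolygon, h, h']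
  exact (affineSegment_vert_subset _ _ _).trans (closedInterior_subset_tiledRegion ⟨i, rfl⟩)

lemma boundary_subset_closure_compl : chainPolygon.boundary ℝ ⊆ closure tiledRegionᶜ := by
  refine Set.iUnion_subset fun j ↦ ?_
  obtain ⟨i, l, l', -, -, k, h, h', hk⟩ := exists_tiles_of_chain_edge j
  rw [edgeSet_chainPolygon, h, h']
  refine (affineSegment_vert_subset _ _ _).trans
    ((Tile.closedInterior_subset_closure_interior _).trans (closure_mono fun p hp hp' ↦ ?_))
  obtain ⟨i', hi'⟩ := Set.mem_iUnion.1 hp'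
  exact hk i' (Tile.eq_of_mem_interior hp hi').symm

/-- Boundary points are limits of points outside the region, so none is interior; what remains is
`openRegion`. -/
lemma interior_tiledRegion : interior tiledRegion = openRegion := by
  refine Set.Subset.antisymm (fun p hp ↦ ?_) (interior_maximal openRegion_subset isOpen_openRegion)
  refine (tiledRegion_subset (interior_subset hp)).resolve_right fun hb ↦ ?_
  have := boundary_subset_closure_compl hb
  rw [closure_compl] at this
  exact this hp

lemma frontier_tiledRegion : frontier tiledRegion = chainPolygon.boundary ℝ := by
  rw [isCompact_tiledRegion.isClosed.frontier_eq, interior_tiledRegion]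
  refine Set.Subset.antisymm (fun p hp ↦ (tiledRegion_subset hp.1).resolve_left hp.2) fun p hp ↦
    ⟨boundary_subset hp, fun hp' ↦ ?_⟩
  have := boundary_subset_closure_compl hp
  rw [closure_compl, interior_tiledRegion] at this
  exact this hp'

lemma closure_interior_tiledRegion : closure (interior tiledRegion) = tiledRegion := by
  refine Set.Subset.antisymm
    (isCompact_tiledRegion.isClosed.closure_subset_iff.2 interior_subset) ?_
  refine Set.iUnion_subset fun i ↦ (Tile.closedInterior_subset_closure_interior _).trans
    (closure_mono (interior_maximal ?_ (Tile.isOpen_interior _)))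
  exact ((tiles i).triangle.interior_subset_closedInterior).trans
    (closedInterior_subset_tiledRegion ⟨i, rfl⟩)

/-- Coefficients from `-3` to `3` suffice, encoded as elements of `Fin 7` shifted by 3. -/
lemma exists_separating_form : ∀ i j : Fin 22, i ≠ j → ∃ a' b' : Fin 7,
    let f : ℤ × ℤ → ℤ := fun z ↦ ((a' : ℕ) - 3 : ℤ) * z.1 + ((b' : ℕ) - 3 : ℤ) * z.2
    f (chain i) ≠ f (chain (i + 1)) ∧ f (chain j) ≠ f (chain (j + 1)) ∧
    f (chain i) ≤ f (chain j) ∧ f (chain i) ≤ f (chain (j + 1)) ∧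
    f (chain (i + 1)) ≤ f (chain j) ∧ f (chain (i + 1)) ≤ f (chain (j + 1)) := by
  decide +kernel

lemma hasNondegenerateVertices_chainPolygon : chainPolygon.HasNondegenerateVertices ℝ := by
  intro i
  apply affineIndependent_of_det_ne_zero
  have : ∀ i : Fin 22, ((chain (i + 1)).1 - (chain i).1) * ((chain (i + 2)).2 - (chain i).2) -
      ((chain (i + 1)).2 - (chain i).2) * ((chain (i + 2)).1 - (chain i).1) ≠ 0 := by
    decide +kernel
  have h := this i
  simp only [chainPolygon, latticePoint_zero, latticePoint_one]
  exact_mod_cast h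

lemma latticePoint_mem_openRegion {a b : ℤ} (h : (a = 0 ∧ b = 0) ∨ (a = 1 ∧ b = 1)) :
    latticePoint (2 * a, 2 * b) ∈ openRegion :=
  star_subset_openRegion h (by simp [Tile.star])

lemma isPolygonalRegion_tiledRegion : IsPolygonalRegion chainPolygon tiledRegion where
  corners := hasNondegenerateVertices_chainPolygon
  edges_inter i j hij := by
    rintro p ⟨hp, hp'⟩
    rw [edgeSet_chainPolygon] at hp hp'
    obtain ⟨a, b, h₁, h₂, h₃, h₄, h₅, h₆⟩ := exists_separating_form i j hij
    rw [finRotate_apply, finRotate_apply]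
    exact mem_endpoints_of_separated _ _ h₁ h₂ h₃ h₄ h₅ h₆ hp hp'
  isCompact := isCompact_tiledRegion
  closure_interior := closure_interior_tiledRegion
  isConnected_interior := by
    rw [interior_tiledRegion]
    exact ⟨⟨_, latticePoint_mem_openRegion (Or.inl ⟨rfl, rfl⟩)⟩, isPreconnected_openRegion⟩
  frontier_eq := frontier_tiledRegion

/-! ### The reflection tiling and the absence of trajectories -/

lemma isReflectionTiling_tiles :
    IsReflectionTiling (fun i : Fin (23 + 1) ↦ (tiles i).triangle) tiledRegion where
  reflect j hj := by
    have : ∀ j : Fin 24, j ≠ 0 → ∃ i < j, ∃ k, tiles j = (tiles i).mirror k := by decide +kernel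
    obtain ⟨i, hij, k, h⟩ := this j hj
    refine ⟨i, hij, ?_⟩
    simp only [h]
    exact Tile.isSideReflection_mirror _ _
  disjoint i j hij := by
    have : Function.Injective tiles := by decide +kernel
    refine Set.disjoint_left.2 fun p hp hp' ↦ hij (this ?_)
    exact Tile.eq_of_mem_interior hp (Affine.Simplex.interior_subset_closedInterior _ hp')
  iUnion_eq := rfl

lemma latticePoint_mem_latticeClass_iff {z : ℤ × ℤ} {c : ℤ} :
    latticePoint z ∈ latticeClass c ↔ z.1 ≡ c [ZMOD 2] ∧ z.2 ≡ c [ZMOD 2] := by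
  refine ⟨?_, fun h ↦ ⟨z, rfl, h⟩⟩
  rintro ⟨w, hw, h⟩
  rwa [latticePoint_injective hw]

lemma not_illuminates_tiledRegion {A B : Plane} (hA : A ∈ latticeClass 0)
    (hB : B ∈ latticeClass 0) : ¬ Illuminates chainPolygon tiledRegion A B := by
  refine not_illuminates_of_latticeClass (v := chain) (fun _ ↦ rfl) ?_ (fun z hz hc ↦ ?_) hA hB
  · have : ∀ j : Fin 22, IsTileEdge (chain j) (chain (j + 1)) := by decide +kernel
    simpa using this
  · obtain ⟨i, hi⟩ := Set.mem_iUnion.1 hz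
    obtain ⟨l, rfl⟩ := Tile.exists_vert_of_latticePoint_mem hi
    -- Vertex `0` of a tile is even in both coordinates and so exempt; the other two must be corners
    -- of the polygon.
    have : ∀ i : Fin 24, ∀ l, l ≠ 0 → ∃ j, (tiles i).vert l = chain j := by decide +kernel
    refine this i l ?_
    rintro rfl
    exact hc (latticePoint_mem_latticeClass_iff.2 (by simp [Tile.vert, Int.ModEq]))

lemma Tile.not_illuminates (τ : Tile) {c : ℤ} {A B : Plane} (hA : A ∈ latticeClass c)
    (hB : B ∈ latticeClass c) :
    ¬ Illuminates τ.triangle.toPolygon τ.triangle.closedInterior A B := by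
  refine not_illuminates_of_latticeClass (v := τ.vert) (fun _ ↦ rfl) ?_
    (fun z hz _ ↦ exists_vert_of_latticePoint_mem hz) hA hB
  have : ∀ j : Fin 3, IsTileEdge (τ.vert j) (τ.vert (j + 1)) := by
    obtain ⟨a, b, s, t, w⟩ := τ
    intro j
    fin_cases j <;> cases s <;> cases t <;> cases w <;> simp [vert, boolSign, IsTileEdge] <;> omega
  simpa using this

theorem mainTheorem3 :
    (∃ (P : Polygon Plane 22) (Q : Set Plane) (m : ℕ) (T : Fin (m + 1) → Affine.Triangle ℝ Plane)
        (A B : Plane),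
      IsPolygonalRegion P Q ∧
      IsRightIsosceles (T 0) ∧
      IsReflectionTiling T Q ∧
      A ∈ interior Q ∧ B ∈ interior Q ∧ A ≠ B ∧
      (∃ i j, A = (T i).points 0 ∧ B = (T j).points 0) ∧
      (∀ v : Fin 3, v ≠ 1 → ¬ Illuminates (T 0).toPolygon (T 0).closedInterior
        ((T 0).points v) ((T 0).points v)) ∧
      ¬ Illuminates P Q A B) ∧
    ∃ n ≤ 22, IsLeast nonIlluminableSideNumbers n := by
  have hA : latticePoint (2 * 0, 2 * 0) ∈ interior tiledRegion := by
    rw [interior_tiledRegion]; exact latticePoint_mem_openRegion (Or.inl ⟨rfl, rfl⟩)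
  have hB : latticePoint (2 * 1, 2 * 1) ∈ interior tiledRegion := by
    rw [interior_tiledRegion]; exact latticePoint_mem_openRegion (Or.inr ⟨rfl, rfl⟩)
  have hAB : latticePoint (2 * 0, 2 * 0) ≠ latticePoint (2 * 1, 2 * 1) :=
    fun h ↦ absurd (latticePoint_injective h) (by decide)
  have hill : ¬ Illuminates chainPolygon tiledRegion (latticePoint (2 * 0, 2 * 0))
      (latticePoint (2 * 1, 2 * 1)) :=
    not_illuminates_tiledRegion (latticePoint_mem_latticeClass_iff.2 (by decide))
      (latticePoint_mem_latticeClass_iff.2 (by decide))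
  have hmem : 22 ∈ nonIlluminableSideNumbers :=
    ⟨inferInstance, chainPolygon, tiledRegion, isPolygonalRegion_tiledRegion, _, hA, _, hB, hAB,
      hill⟩
  -- Tile `0` is a tile around `(0, 0)` and tile `10` one around `(2, 2)`.
  refine ⟨⟨chainPolygon, tiledRegion, 23, fun i ↦ (tiles i).triangle, _, _,
    isPolygonalRegion_tiledRegion, (tiles 0).isRightIsosceles, isReflectionTiling_tiles, hA, hB, hAB,
    ⟨0, 10, rfl, rfl⟩, fun v hv ↦ ?_, hill⟩, sInf nonIlluminableSideNumbers, Nat.sInf_le hmem,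
    Nat.sInf_mem ⟨_, hmem⟩, fun _ ↦ Nat.sInf_le⟩
  -- The acute vertex `0` has class 0, the acute vertex `2` class 1.
  have : ∀ v : Fin 3, v ≠ 1 → ∃ c : Fin 2, ((tiles 0).vert v).1 ≡ (c : ℕ) [ZMOD 2] ∧
      ((tiles 0).vert v).2 ≡ (c : ℕ) [ZMOD 2] := by decide
  obtain ⟨c, hc⟩ := this v hv
  exact (tiles 0).not_illuminates (latticePoint_mem_latticeClass_iff.2 hc)
    (latticePoint_mem_latticeClass_iff.2 hc)
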